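/- **Setting.** An ad query is a triple $(v,x,q)$: a value $v\in[0,1]$, a non-decreasing allocation function $x:[0,\infty)\to[0,1]$ with $x(0)=0$, and a non-decreasing payment function $q:[0,\infty)\to[0,1]$ with $q(b)\le b$ and $q(b)=0$ whenever $x(b)=0$; put $p(b)=q(b)x(b)$. For a horizon $T\ge 1$, queries $(v_t,x_t,q_t)$, $t=1,\dots,T$, are drawn i.i.d. from a distribution $\mathcal D$. An online algorithm $\mathcal A$ (possibly randomized, possibly depending on $T$, not knowing $\mathcal D$) chooses its bid $b_t\ge 0$ from $(v_\tau,x_\tau(b_\tau),p_\tau(b_\tau))_{\tau<t}$, the value $v_t$ and its own independent randomness. Let $$V_{\mathcal A}(\mathcal D,T)=\mathbb E\sum_{t=1}^T v_tx_t(b_t),\qquad \mathrm{CCV}_{\mathcal A}(T)=\sum_{t=1}^T\bigl(p_t(b_t)-v_tx_t(b_t)\bigr).$$ The return-on-spend constraint (ROSC) is $\mathbb E\sum_t p_t(b_t)\le \mathbb E\sum_t v_tx_t(b_t)$. Let $V_{\mathsf{OPT}}(\mathcal D,T)$ be the supremum of $V_{\mathcal B}(\mathcal D,T)$ over all such bidding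 algorithms $\mathcal B$, which may be chosen knowing $\mathcal D$, that satisfy the ROSC under $\mathcal D$. For a class $\mathfrak D$ of distributions let $$\mathcal R_{\mathcal A}(T;\mathfrak D)=\sup_{\mathcal D\in\mathfrak D}\bigl(V_{\mathsf{OPT}}(\mathcal D,T)-V_{\mathcal A}(\mathcal D,T)\bigr),\qquad \mathcal C_{\mathcal A}(T;\mathfrak D)=\sup_{\mathcal D\in\mathfrak D}\mathbb E_{\mathcal D}[\mathrm{CCV}_{\mathcal A}(T)].$$ **Theorem.** Let $0<v<1$, and let $\mathfrak D_v$ be the class of all distributions with $v_t=v$ for all $t$ (repeated identical auction). There is a constant $c>0$, depending only on $v$, such that for every $T\ge1$ and every online algorithm $\mathcal A$ $$\mathcal R_{\mathcal A}(T;\mathfrak D_v)+\mathcal C_{\mathcal A}(T;\mathfrak D_v)\ \ge\ c\sqrt T .$$ The same holds with $\mathfrak D_v$ replaced by its subclass of threshold inputs, where $x_t(b)=\mathbf 1\{b\ge\theta_t\}$ and $p_t(b)=\theta_t\mathbf 1\{b\ge\theta_t\}$ with random $\theta_t\in(0,1]$. -/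

import Mathlib

open MeasureTheory
open scoped NNReal

noncomputable section

namespace AutoBid

/-- The law of one ad query `(v, x, q)`, presented as a random element on a probability space:
a value `v ∈ [0,1]`, a non-decreasing allocation function `x : [0,∞) → [0,1]` with `x 0 = 0`, and a
non-decreasing per-win payment function `q : [0,∞) → [0,1]` that vanishes where `x` does and is at
most the bid. -/
structure InputLaw where
  Ω : Type
  [mΩ : MeasurableSpace Ω]
  law : Measure Ω
  [isProb : IsProbabilityMeasure law]
  value : Ω → ℝ
  alloc : Ω → ℝ≥0 → ℝ
  price : Ω → ℝ≥0 → ℝ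
  measurable_value : Measurable value
  measurable_alloc : Measurable (fun z : Ω × ℝ≥0 => alloc z.1 z.2)
  measurable_price : Measurable (fun z : Ω × ℝ≥0 => price z.1 z.2)
  value_mem : ∀ ω, value ω ∈ Set.Icc (0 : ℝ) 1
  alloc_mem : ∀ ω b, alloc ω b ∈ Set.Icc (0 : ℝ) 1
  alloc_mono : ∀ ω, Monotone (alloc ω)
  alloc_zero : ∀ ω, alloc ω 0 = 0
  price_mem : ∀ ω b, price ω b ∈ Set.Icc (0 : ℝ) 1
  price_mono : ∀ ω, Monotone (price ω)
  price_eq_zero : ∀ ω b, alloc ω b = 0 → price ω b = 0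
  price_le_bid : ∀ ω b, price ω b ≤ b

attribute [instance] InputLaw.mΩ InputLaw.isProb

/-- The expected payment function `p = q x`. -/
def InputLaw.payment (D : InputLaw) (ω : D.Ω) (b : ℝ≥0) : ℝ :=
  D.price ω b * D.alloc ω b

/-- A (possibly randomized) online bidding algorithm. In slot `t` (slots are numbered from `0`)
the bid is a function of an internal random seed, of the triples `(v_τ, x_τ(b_τ), p_τ(b_τ))`
observed in the slots `τ < t`, and of the current value `v_t`. -/
structure OnlineAlg where
  Seed : Type
  [mSeed : MeasurableSpace Seed]
  seedLaw : Measure Seed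
  [isProb : IsProbabilityMeasure seedLaw]
  bid : (t : ℕ) → Seed → (Fin t → ℝ × ℝ × ℝ) → ℝ → ℝ≥0
  measurable_bid : ∀ t : ℕ, Measurable
    (fun z : Seed × (Fin t → ℝ × ℝ × ℝ) × ℝ => bid t z.1 z.2.1 z.2.2)

attribute [instance] OnlineAlg.mSeed OnlineAlg.isProb

/-- What algorithm `A` with seed `s` has observed before slot `t`, on the input sequence `ω`. -/
def history (A : OnlineAlg) (D : InputLaw) {T : ℕ} (ω : Fin T → D.Ω) (s : A.Seed) :
    (t : ℕ) → t ≤ T → (Fin t → ℝ × ℝ × ℝ)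
  | 0, _ => Fin.elim0
  | t + 1, h =>
      let past := history A D ω s t (Nat.le_of_succ_le h)
      let q : D.Ω := ω ⟨t, h⟩
      let b : ℝ≥0 := A.bid t s past (D.value q)
      Fin.snoc (α := fun _ => ℝ × ℝ × ℝ) past (D.value q, D.alloc q b, D.payment q b)

/-- The bid `b_t` of `A` with seed `s` in slot `t`, on the input sequence `ω`. -/
def bidAt (A : OnlineAlg) (D : InputLaw) {T : ℕ} (ω : Fin T → D.Ω) (s : A.Seed) (t : Fin T) :
    ℝ≥0 :=
  A.bid t s (history A D ω s t t.isLt.le) (D.value (ω t))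

/-- The joint law of `T` i.i.d. queries drawn from `D` and of the independent seed of `A`. -/
def runLaw (A : OnlineAlg) (D : InputLaw) (T : ℕ) : Measure ((Fin T → D.Ω) × A.Seed) :=
  (Measure.pi fun _ : Fin T => D.law).prod A.seedLaw

/-- The accrued valuation `∑ v_t x_t(b_t)` on a sample path. -/
def pathValue (A : OnlineAlg) (D : InputLaw) (T : ℕ) (z : (Fin T → D.Ω) × A.Seed) : ℝ :=
  ∑ t : Fin T, D.value (z.1 t) * D.alloc (z.1 t) (bidAt A D z.1 z.2 t)

/-- The total payment `∑ p_t(b_t)` on a sample path. -/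
def pathPayment (A : OnlineAlg) (D : InputLaw) (T : ℕ) (z : (Fin T → D.Ω) × A.Seed) : ℝ :=
  ∑ t : Fin T, D.payment (z.1 t) (bidAt A D z.1 z.2 t)

/-- `CCV(T) = ∑ (p_t(b_t) - v_t x_t(b_t))` on a sample path. -/
def pathCCV (A : OnlineAlg) (D : InputLaw) (T : ℕ) (z : (Fin T → D.Ω) × A.Seed) : ℝ :=
  ∑ t : Fin T, (D.payment (z.1 t) (bidAt A D z.1 z.2 t)
    - D.value (z.1 t) * D.alloc (z.1 t) (bidAt A D z.1 z.2 t))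

/-- `V_A(T)`, the expected accrued valuation of `A` under `D`. -/
def expValue (A : OnlineAlg) (D : InputLaw) (T : ℕ) : ℝ :=
  ∫ z, pathValue A D T z ∂(runLaw A D T)

/-- `E[CCV_A(T)]` under `D`. -/
def expCCV (A : OnlineAlg) (D : InputLaw) (T : ℕ) : ℝ :=
  ∫ z, pathCCV A D T z ∂(runLaw A D T)

/-- The return-on-spend constraint: the expected total payment is at most the expected accrued
valuation. -/
def SatisfiesROSC (A : OnlineAlg) (D : InputLaw) (T : ℕ) : Prop :=
  ∫ z, pathPayment A D T z ∂(runLaw A D T) ≤ ∫ z, pathValue A D T z ∂(runLaw A D T)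

/-- `V_OPT(T)`: the best expected accrued valuation under `D` of a bidding algorithm that may be
chosen knowing `D` (but does not see the realizations in advance) and satisfies the return-on-spend
constraint under `D`. All the values lie in `[0, T]`, and bidding `0` is feasible. -/
def optValue (D : InputLaw) (T : ℕ) : ℝ :=
  sSup {r : ℝ | ∃ B : OnlineAlg, SatisfiesROSC B D T ∧ r = expValue B D T}

/-- The regret of `A` at horizon `T`, worst case over the input laws in the class `𝒟`. (The
differences lie in `[-T, T]`.) -/
def regret (𝒟 : Set InputLaw) (A : OnlineAlg) (T : ℕ) : ℝ :=
  sSup {r : ℝ | ∃ D ∈ 𝒟, r = optValue D T - expValue A D T}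

/-- The expected cumulative constraint violation of `A` at horizon `T`, worst case over the input
laws in the class `𝒟`. (The expectations lie in `[-T, T]`.) -/
def worstCCV (𝒟 : Set InputLaw) (A : OnlineAlg) (T : ℕ) : ℝ :=
  sSup {r : ℝ | ∃ D ∈ 𝒟, r = expCCV A D T}

/-- Repeated identical auctions: every query has the value `v`. -/
def repeatedLaws (v : ℝ) : Set InputLaw :=
  {D | ∀ ω, D.value ω = v}

/-- Repeated identical auctions of threshold type: `x(b) = 1` and `p(b) = θ` for `b ≥ θ`, and both
are `0` for `b < θ`, with a random threshold `θ ≤ 1`. -/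
def thresholdLaws (v : ℝ) : Set InputLaw :=
  {D | (∀ ω, D.value ω = v) ∧ ∀ ω, ∃ θ : ℝ≥0, θ ≤ 1 ∧ ∀ b : ℝ≥0,
    D.alloc ω b = (if θ ≤ b then 1 else 0) ∧ D.payment ω b = (if θ ≤ b then (θ : ℝ) else 0)}

end AutoBid

end

noncomputable section

namespace AutoBid

/-! ### A priori bounds -/

/-! Take thresholds `v - d` and `v + d`, the low one with probability 1/2, 1/2 - ε or 1/2 - 2ε,
where ε is of order 1/√T, and let E₀, E₁, E₂ be the expected numbers of bids below the high price.
With the fair coin, always bidding high meets the ROSC exactly, so each low bid costs regret: E₀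
must be small. With bias 1/2 - ε, always bidding high overspends by order √T and a low bid saves at
most `d` in expectation: a small violation forces E₁ to be of order √T.

The joint laws of T coins stay within constant distance, but this alone does not transfer a bound on
E₀ to E₁, because the count of low bids can reach T on a rare event. The third bias controls this:
there a schedule with about √T low bids is feasible, so small regret forces E₂ = O(√T).
Cauchy–Schwarz on the product weights gives E₁² ≤ 2E₀E₂ (`sq_expLowCount_half_le`), which is
incompatible with the three bounds (`add_lower_bound`). -/

theorem payment_mem (D : InputLaw) (ω : D.Ω) (b : ℝ≥0) : D.payment ω b ∈ Set.Icc (0 : ℝ) 1 := by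
  obtain ⟨h0, h1⟩ := D.price_mem ω b
  obtain ⟨k0, k1⟩ := D.alloc_mem ω b
  exact ⟨mul_nonneg h0 k0, mul_le_one₀ h1 k0 k1⟩

theorem gain_mem (D : InputLaw) (ω : D.Ω) (b : ℝ≥0) :
    D.value ω * D.alloc ω b ∈ Set.Icc (0 : ℝ) 1 := by
  obtain ⟨h0, h1⟩ := D.value_mem ω
  obtain ⟨k0, k1⟩ := D.alloc_mem ω b
  exact ⟨mul_nonneg h0 k0, mul_le_one₀ h1 k0 k1⟩

theorem abs_sum_fin_le {T : ℕ} {f : Fin T → ℝ} (hf : ∀ t, |f t| ≤ 1) : |∑ t, f t| ≤ T := by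
  calc |∑ t, f t| ≤ ∑ t, |f t| := Finset.abs_sum_le_sum_abs _ _
    _ ≤ ∑ _t : Fin T, (1 : ℝ) := Finset.sum_le_sum fun t _ => hf t
    _ = T := by simp

instance (A : OnlineAlg) (D : InputLaw) (T : ℕ) : IsProbabilityMeasure (runLaw A D T) := by
  unfold runLaw; infer_instance

theorem abs_pathValue_le (A : OnlineAlg) (D : InputLaw) (T : ℕ) (z : (Fin T → D.Ω) × A.Seed) :
    |pathValue A D T z| ≤ T :=
  abs_sum_fin_le fun t => by
    obtain ⟨h0, h1⟩ := gain_mem D (z.1 t) (bidAt A D z.1 z.2 t)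
    exact abs_le.2 ⟨by linarith, h1⟩

theorem abs_pathCCV_le (A : OnlineAlg) (D : InputLaw) (T : ℕ) (z : (Fin T → D.Ω) × A.Seed) :
    |pathCCV A D T z| ≤ T :=
  abs_sum_fin_le fun t => by
    obtain ⟨h0, h1⟩ := gain_mem D (z.1 t) (bidAt A D z.1 z.2 t)
    obtain ⟨k0, k1⟩ := payment_mem D (z.1 t) (bidAt A D z.1 z.2 t)
    exact abs_le.2 ⟨by linarith, by linarith⟩

theorem abs_integral_le_of_abs_le {α : Type*} [MeasurableSpace α] (μ : Measure α)
    [IsProbabilityMeasure μ] {f : α → ℝ} {C : ℝ} (hf : ∀ x, |f x| ≤ C) : |∫ x, f x ∂μ| ≤ C := by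
  simpa using norm_integral_le_of_norm_le_const (μ := μ) (f := f) (C := C)
    (Filter.Eventually.of_forall hf)

theorem abs_expValue_le (A : OnlineAlg) (D : InputLaw) (T : ℕ) : |expValue A D T| ≤ T :=
  abs_integral_le_of_abs_le _ (abs_pathValue_le A D T)

theorem abs_expCCV_le (A : OnlineAlg) (D : InputLaw) (T : ℕ) : |expCCV A D T| ≤ T :=
  abs_integral_le_of_abs_le _ (abs_pathCCV_le A D T)

theorem optValue_le (D : InputLaw) (T : ℕ) : optValue D T ≤ T := by
  refine Real.sSup_le ?_ (Nat.cast_nonneg T)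
  rintro r ⟨B, -, rfl⟩
  exact (abs_le.1 (abs_expValue_le B D T)).2

theorem expValue_le_optValue {D : InputLaw} {T : ℕ} {B : OnlineAlg} (hB : SatisfiesROSC B D T) :
    expValue B D T ≤ optValue D T := by
  refine le_csSup ⟨T, ?_⟩ ⟨B, hB, rfl⟩
  rintro r ⟨B, -, rfl⟩
  exact (abs_le.1 (abs_expValue_le B D T)).2

/-- The a priori bound makes the real `sSup` a genuine supremum; on an unbounded set it would
default to 0. -/
theorem le_regret {𝒟 : Set InputLaw} {D : InputLaw} (hD : D ∈ 𝒟) (A : OnlineAlg) (T : ℕ) :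
    optValue D T - expValue A D T ≤ regret 𝒟 A T := by
  refine le_csSup ⟨T + T, ?_⟩ ⟨D, hD, rfl⟩
  rintro r ⟨D, -, rfl⟩
  linarith [optValue_le D T, (abs_le.1 (abs_expValue_le A D T)).1]

theorem le_worstCCV {𝒟 : Set InputLaw} {D : InputLaw} (hD : D ∈ 𝒟) (A : OnlineAlg) (T : ℕ) :
    expCCV A D T ≤ worstCCV 𝒟 A T := by
  refine le_csSup ⟨T, ?_⟩ ⟨D, hD, rfl⟩
  rintro r ⟨D, -, rfl⟩
  exact (abs_le.1 (abs_expCCV_le A D T)).2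

/-! ### Non-anticipation -/

theorem history_congr (A : OnlineAlg) (D : InputLaw) {T : ℕ} {ω ω' : Fin T → D.Ω} (s : A.Seed) :
    ∀ (t : ℕ) (h : t ≤ T), (∀ i : Fin T, (i : ℕ) < t → ω i = ω' i) →
      history A D ω s t h = history A D ω' s t h
  | 0, _, _ => rfl
  | t + 1, h, hω => by
    have ih := history_congr A D s t (Nat.le_of_succ_le h) fun i hi => hω i (by omega)
    simp only [history]
    rw [ih, hω ⟨t, h⟩ (Nat.lt_succ_self t)]

/-! ### Sums over product weights -/

/-- The probability of the sequence `ω` under `p`-biased coin flips. -/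
def bernoulliWeight {T : ℕ} (p : ℝ) (ω : Fin T → Bool) : ℝ :=
  ∏ t, if ω t then p else 1 - p

theorem bernoulliWeight_nonneg {T : ℕ} {p : ℝ} (h0 : 0 ≤ p) (h1 : p ≤ 1) (ω : Fin T → Bool) :
    0 ≤ bernoulliWeight p ω :=
  Finset.prod_nonneg fun t _ => by split_ifs <;> linarith

theorem sum_bernoulliWeight {T : ℕ} (p : ℝ) :
    ∑ ω : Fin T → Bool, bernoulliWeight p ω = 1 := by
  have := Fintype.sum_pow (fun b : Bool => if b then p else 1 - p) T
  simp at this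
  exact this.symm

/-- Fubini in coordinate `t`: since `f` ignores that coin, the coin is independent of it and can be
averaged out first. It is applied with the bid of slot `t` as `f`. -/
theorem sum_bernoulliWeight_mul {T : ℕ} (p : ℝ) (t : Fin T) {β : Type*} (f : (Fin T → Bool) → β)
    (hf : ∀ ω ω', (∀ i, i ≠ t → ω i = ω' i) → f ω = f ω') (g : Bool → β → ℝ) :
    ∑ ω, bernoulliWeight p ω * g (ω t) (f ω)
      = ∑ ω, bernoulliWeight p ω * (p * g true (f ω) + (1 - p) * g false (f ω)) := by
  obtain _ | n := T
  · exact t.elim0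
  set e := Fin.insertNthEquiv (fun _ : Fin (n + 1) => Bool) t
  have he : ∀ x ρ, e (x, ρ) t = x := fun x ρ => by simp [e]
  have he' : ∀ x ρ i, e (x, ρ) (t.succAbove i) = ρ i := fun x ρ i => by simp [e]
  have key : ∀ x ρ, bernoulliWeight p (e (x, ρ))
      = (if x then p else 1 - p) * bernoulliWeight p ρ := fun x ρ => by
    simp only [bernoulliWeight, Fin.prod_univ_succAbove _ t, he, he']
  have hf' : ∀ ρ, f (e (true, ρ)) = f (e (false, ρ)) := fun ρ => hf _ _ fun i hi => by
    obtain ⟨j, rfl⟩ := Fin.exists_succAbove_eq hi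
    rw [he', he']
  rw [← e.sum_comp, ← e.sum_comp, Fintype.sum_prod_type, Fintype.sum_prod_type]
  simp only [key, Fintype.sum_bool, hf', he]
  rw [← Finset.sum_add_distrib, ← Finset.sum_add_distrib]
  exact Finset.sum_congr rfl fun ρ _ => by simp; ring

/-- Factor by factor, (p + ε)(p - ε) = p² - ε², and likewise for 1 - p, so each coin loses at most a
factor 1 - δ. -/
theorem bernoulliWeight_sq_le {T : ℕ} {p ε δ : ℝ} (hδ : δ ≤ 1)
    (hp : (1 - δ) * p ^ 2 ≤ p ^ 2 - ε ^ 2)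
    (hq : (1 - δ) * (1 - p) ^ 2 ≤ (1 - p) ^ 2 - ε ^ 2) (ω : Fin T → Bool) :
    (1 - δ) ^ T * bernoulliWeight p ω ^ 2
      ≤ bernoulliWeight (p + ε) ω * bernoulliWeight (p - ε) ω := by
  have : (1 - δ) ^ T = ∏ _t : Fin T, (1 - δ) := by simp
  rw [this, bernoulliWeight, bernoulliWeight, bernoulliWeight, ← Finset.prod_pow,
    ← Finset.prod_mul_distrib, ← Finset.prod_mul_distrib]
  refine Finset.prod_le_prod (fun t _ => mul_nonneg (by linarith) (sq_nonneg _)) fun t _ => ?_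
  split_ifs <;> nlinarith

/-- If the coin biases form an arithmetic progression, then the square of the middle expectation is
controlled by the product of the outer ones. -/
theorem sq_sum_bernoulliWeight_le {T : ℕ} {p ε δ : ℝ} (h0 : 0 ≤ p - ε) (h1 : p + ε ≤ 1)
    (hε : 0 ≤ ε) (hδ : δ ≤ 1) (hp : (1 - δ) * p ^ 2 ≤ p ^ 2 - ε ^ 2)
    (hq : (1 - δ) * (1 - p) ^ 2 ≤ (1 - p) ^ 2 - ε ^ 2)
    {f : (Fin T → Bool) → ℝ} (hf : ∀ ω, 0 ≤ f ω) :
    (1 - δ) ^ T * (∑ ω, bernoulliWeight p ω * f ω) ^ 2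
      ≤ (∑ ω, bernoulliWeight (p + ε) ω * f ω) * ∑ ω, bernoulliWeight (p - ε) ω * f ω := by
  have hr : 0 ≤ (1 - δ) ^ T := pow_nonneg (by linarith) _
  -- Cauchy–Schwarz; the square root in `r` makes its square carry exactly the factor (1 - δ)^T.
  have h2 := Finset.sum_sq_le_sum_mul_sum_of_sq_le_mul (R := ℝ) Finset.univ
    (r := fun ω => √((1 - δ) ^ T) * (bernoulliWeight p ω * f ω))
    (f := fun ω => bernoulliWeight (p + ε) ω * f ω)
    (g := fun ω => bernoulliWeight (p - ε) ω * f ω)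
    (fun ω _ => mul_nonneg (bernoulliWeight_nonneg (by linarith) (by linarith) ω) (hf ω))
    (fun ω _ => mul_nonneg (bernoulliWeight_nonneg (by linarith) (by linarith) ω) (hf ω))
    (fun ω _ => by
      rw [mul_pow, Real.sq_sqrt hr]
      calc _ = ((1 - δ) ^ T * bernoulliWeight p ω ^ 2) * f ω ^ 2 := by ring
        _ ≤ (bernoulliWeight (p + ε) ω * bernoulliWeight (p - ε) ω) * f ω ^ 2 :=
          mul_le_mul_of_nonneg_right (bernoulliWeight_sq_le hδ hp hq ω) (sq_nonneg _)
        _ = _ := by ring)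
  rwa [← Finset.mul_sum, mul_pow, Real.sq_sqrt hr] at h2

/-! ### Auctions with two threshold prices -/

/-- A repeated threshold auction with value `v`, whose threshold takes one of two values. -/
structure TwoPriceAuction where
  v : ℝ
  lo : ℝ≥0
  hi : ℝ≥0
  v_mem : v ∈ Set.Icc (0 : ℝ) 1
  lo_pos : 0 < lo
  lo_lt_hi : lo < hi
  hi_le_one : hi ≤ 1

namespace TwoPriceAuction

variable (P : TwoPriceAuction)

/-- The threshold: low on `true`, high on `false`. -/
def threshold (x : Bool) : ℝ≥0 := if x then P.lo else P.hi

theorem threshold_pos (x : Bool) : 0 < P.threshold x := by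
  cases x
  · exact P.lo_pos.trans P.lo_lt_hi
  · exact P.lo_pos

theorem threshold_le_one (x : Bool) : P.threshold x ≤ 1 := by
  cases x
  · exact P.hi_le_one
  · exact P.lo_lt_hi.le.trans P.hi_le_one

/-- The law of a coin that shows `true` with probability `p`. -/
def coin (p : unitInterval) : Measure Bool :=
  ENNReal.ofReal p • Measure.dirac true + ENNReal.ofReal (1 - p) • Measure.dirac false

instance (p : unitInterval) : IsProbabilityMeasure (coin p) := by
  constructor
  simp only [coin, Measure.coe_add, Measure.coe_smul, Pi.add_apply, Pi.smul_apply, measure_univ,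
    smul_eq_mul, mul_one]
  rw [← ENNReal.ofReal_add p.2.1 (by linarith [p.2.2])]
  simp

theorem coin_real_singleton (p : unitInterval) (x : Bool) :
    (coin p).real {x} = if x then (p : ℝ) else 1 - p := by
  have h0 := p.2.1
  have h1 := p.2.2
  cases x <;> simp [coin, Measure.real, h0, h1]

theorem pi_coin_real_singleton {T : ℕ} (p : unitInterval) (ω : Fin T → Bool) :
    (Measure.pi fun _ : Fin T => coin p).real {ω} = bernoulliWeight p ω := by
  simp only [Measure.real, Measure.pi_singleton, ENNReal.toReal_prod, bernoulliWeight]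
  exact Finset.prod_congr rfl fun t _ => coin_real_singleton p (ω t)

theorem measurable_ite_threshold (c : Bool → ℝ) :
    Measurable fun z : Bool × ℝ≥0 => if P.threshold z.1 ≤ z.2 then c z.1 else 0 := by
  refine Measurable.ite (measurableSet_le ?_ measurable_snd) ?_ measurable_const
  · exact (measurable_of_finite P.threshold).comp measurable_fst
  · exact (measurable_of_finite c).comp measurable_fst

/-- The input law under which the threshold is low with probability `p`. -/
def inputLaw (p : unitInterval) : InputLaw where
  Ω := Bool
  law := coin p
  value _ := P.v
  alloc x b := if P.threshold x ≤ b then 1 else 0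
  price x b := if P.threshold x ≤ b then (P.threshold x : ℝ) else 0
  measurable_value := measurable_const
  measurable_alloc := P.measurable_ite_threshold fun _ => 1
  measurable_price := P.measurable_ite_threshold fun x => P.threshold x
  value_mem _ := P.v_mem
  alloc_mem x b := by split_ifs <;> simp
  alloc_mono x b b' h := by
    dsimp only
    split_ifs with h1 h2
    · exact le_rfl
    · exact absurd (h1.trans h) h2
    · exact zero_le_one
    · exact le_rfl
  alloc_zero x := if_neg (not_le.2 (P.threshold_pos x))
  price_mem x b := by
    have := P.threshold_le_one x
    split_ifs
    · exact ⟨NNReal.coe_nonneg _, by exact_mod_cast this⟩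
    · simp
  price_mono x b b' h := by
    dsimp only
    split_ifs with h1 h2
    · exact le_rfl
    · exact absurd (h1.trans h) h2
    · exact NNReal.coe_nonneg _
    · exact le_rfl
  price_eq_zero x b h := by
    by_contra h'
    split_ifs at h h'
    · exact one_ne_zero h
    · exact h' rfl
  price_le_bid x b := by
    split_ifs with h
    · exact_mod_cast h
    · exact NNReal.coe_nonneg _

theorem payment_inputLaw (p : unitInterval) (x : Bool) (b : ℝ≥0) :
    (P.inputLaw p).payment x b = if P.threshold x ≤ b then (P.threshold x : ℝ) else 0 := by
  simp only [InputLaw.payment, inputLaw]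
  split_ifs <;> simp

theorem inputLaw_mem (p : unitInterval) : P.inputLaw p ∈ thresholdLaws P.v :=
  ⟨fun _ => rfl, fun x => ⟨P.threshold x, P.threshold_le_one x, fun b =>
    ⟨rfl, P.payment_inputLaw p x b⟩⟩⟩

/-! ### Running an algorithm on a two-price auction -/

variable (A : OnlineAlg) {T : ℕ}

theorem history_inputLaw (p p' : unitInterval) (ω : Fin T → Bool) (s : A.Seed) :
    ∀ (t : ℕ) (h : t ≤ T),
      history A (P.inputLaw p) ω s t h = history A (P.inputLaw p') ω s t h
  | 0, _ => rfl
  | t + 1, h => by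
    have ih := history_inputLaw p p' ω s t (Nat.le_of_succ_le h)
    simp only [history]
    rw [ih]
    rfl

/-- The bid in slot `t`, which depends on the realized thresholds but not on their law. -/
def bid (ω : Fin T → Bool) (s : A.Seed) (t : Fin T) : ℝ≥0 :=
  -- The bias 0 is an arbitrary choice: the run on given realizations is the same for every bias.
  bidAt A (P.inputLaw 0) ω s t

theorem bidAt_inputLaw (p : unitInterval) (ω : Fin T → Bool) (s : A.Seed) (t : Fin T) :
    bidAt A (P.inputLaw p) ω s t = P.bid A ω s t := by
  simp only [bid, bidAt]
  rw [P.history_inputLaw A p 0 ω s]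
  rfl

theorem bid_congr (s : A.Seed) (t : Fin T) (ω ω' : Fin T → Bool)
    (h : ∀ i, i ≠ t → ω i = ω' i) : P.bid A ω s t = P.bid A ω' s t := by
  simp only [bid, bidAt]
  rw [history_congr A (P.inputLaw 0) (ω := ω) (ω' := ω') s t t.isLt.le
    fun i hi => h i (Fin.ne_of_lt hi)]
  rfl

theorem measurable_history (ω : Fin T → Bool) :
    ∀ (t : ℕ) (h : t ≤ T), Measurable fun s => history A (P.inputLaw 0) ω s t h
  | 0, _ => measurable_const
  | t + 1, h => by
    have ih := measurable_history ω t (Nat.le_of_succ_le h)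
    have hb : Measurable fun s => A.bid t s
        (history A (P.inputLaw 0) ω s t (Nat.le_of_succ_le h)) P.v :=
      (A.measurable_bid t).comp (measurable_id.prodMk (ih.prodMk measurable_const))
    have hx : Measurable fun b => (P.inputLaw 0).alloc (ω ⟨t, h⟩) b :=
      (P.inputLaw 0).measurable_alloc.comp (measurable_const.prodMk measurable_id)
    have hq : Measurable fun b => (P.inputLaw 0).price (ω ⟨t, h⟩) b :=
      (P.inputLaw 0).measurable_price.comp (measurable_const.prodMk measurable_id)
    refine measurable_pi_iff.2 fun i => ?_
    simp only [history]
    refine Fin.lastCases ?_ (fun j => ?_) i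
    · simp only [Fin.snoc_last]
      exact measurable_const.prodMk ((hx.comp hb).prodMk ((hq.comp hb).mul (hx.comp hb)))
    · simp only [Fin.snoc_castSucc]
      exact (measurable_pi_apply j).comp ih

theorem measurable_bid (ω : Fin T → Bool) (t : Fin T) : Measurable fun s => P.bid A ω s t :=
  (A.measurable_bid t).comp
    (measurable_id.prodMk ((P.measurable_history A ω t t.isLt.le).prodMk measurable_const))

theorem integrable_of_abs_le {α : Type*} [MeasurableSpace α] {μ : Measure α} [IsFiniteMeasure μ]
    {f : α → ℝ} {C : ℝ} (hf : Measurable f) (hC : ∀ x, |f x| ≤ C) : Integrable f μ :=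
  Integrable.of_bound hf.aestronglyMeasurable C (Filter.Eventually.of_forall hC)

theorem integral_runLaw (p : unitInterval) {F : (Fin T → Bool) → A.Seed → ℝ} {C : ℝ}
    (hF : ∀ ω, Measurable (F ω)) (hC : ∀ ω s, |F ω s| ≤ C) :
    ∫ z, F z.1 z.2 ∂(runLaw A (P.inputLaw p) T)
      = ∫ s, ∑ ω, bernoulliWeight p ω * F ω s ∂A.seedLaw := by
  have hm : Measurable fun z : (Fin T → Bool) × A.Seed => F z.1 z.2 :=
    measurable_from_prod_countable_right hF
  change ∫ z : (Fin T → Bool) × A.Seed, F z.1 z.2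
    ∂((Measure.pi fun _ : Fin T => coin p).prod A.seedLaw) = _
  rw [integral_prod_symm _ (integrable_of_abs_le hm fun z => hC z.1 z.2)]
  refine integral_congr_ae (Filter.Eventually.of_forall fun s => ?_)
  dsimp only
  rw [integral_fintype Integrable.of_finite]
  exact Finset.sum_congr rfl fun ω _ => by rw [pi_coin_real_singleton, smul_eq_mul]

/-- The expectation of a sum of per-slot rewards: the current threshold may be averaged out, since
the bid does not depend on it. -/
theorem integral_sum_reward (p : unitInterval) {g : Bool → ℝ≥0 → ℝ}
    (hg : ∀ x, Measurable (g x)) (hb : ∀ x b, |g x b| ≤ 1) :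
    ∫ z, ∑ t, g (z.1 t) (bidAt A (P.inputLaw p) z.1 z.2 t) ∂(runLaw A (P.inputLaw p) T)
      = ∫ s, ∑ ω : Fin T → Bool, bernoulliWeight p ω * ∑ t,
          (p * g true (P.bid A ω s t) + (1 - p) * g false (P.bid A ω s t)) ∂A.seedLaw := by
  have h1 := P.integral_runLaw A p (F := fun ω s => ∑ t : Fin T, g (ω t) (P.bid A ω s t)) (C := T)
    (fun ω => Finset.measurable_sum _ fun t _ => (hg _).comp (P.measurable_bid A ω t))
    (fun ω s => abs_sum_fin_le fun t => hb _ _)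
  refine Eq.trans ?_ (h1.trans ?_)
  · refine integral_congr_ae (Filter.Eventually.of_forall fun z => ?_)
    exact Finset.sum_congr rfl fun t _ => by rw [P.bidAt_inputLaw A p z.1 z.2 t]
  · refine integral_congr_ae (Filter.Eventually.of_forall fun s => ?_)
    simp only [Finset.mul_sum]
    rw [Finset.sum_comm]
    conv_rhs => rw [Finset.sum_comm]
    exact Finset.sum_congr rfl fun t _ =>
      sum_bernoulliWeight_mul (p : ℝ) t (fun ω => P.bid A ω s t) (P.bid_congr A s t) g

/-! ### Value and violation in terms of the number of low bids -/

/-- The number of slots in which the bid is below the high price. -/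
def lowCount (ω : Fin T → Bool) (s : A.Seed) : ℝ :=
  ∑ t, if P.bid A ω s t < P.hi then 1 else 0

theorem measurable_lowCount (ω : Fin T → Bool) : Measurable (P.lowCount A ω) :=
  Finset.measurable_sum _ fun t _ => Measurable.ite
    (measurableSet_lt (P.measurable_bid A ω t) measurable_const) measurable_const measurable_const

theorem lowCount_nonneg (ω : Fin T → Bool) (s : A.Seed) : 0 ≤ P.lowCount A ω s :=
  Finset.sum_nonneg fun t _ => by split_ifs <;> simp

theorem abs_lowCount_le (ω : Fin T → Bool) (s : A.Seed) : |P.lowCount A ω s| ≤ T :=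
  abs_sum_fin_le fun t => by split_ifs <;> simp

/-- The expected number of slots in which the bid is below the high price, when the low price has
probability `p`. -/
def expLowCount (T : ℕ) (p : ℝ) : ℝ :=
  ∑ ω : Fin T → Bool, bernoulliWeight p ω * ∫ s, P.lowCount A ω s ∂A.seedLaw

theorem integrable_lowCount (ω : Fin T → Bool) : Integrable (P.lowCount A ω) A.seedLaw :=
  integrable_of_abs_le (P.measurable_lowCount A ω) (P.abs_lowCount_le A ω)

theorem expLowCount_nonneg (p : unitInterval) : 0 ≤ P.expLowCount A T p :=
  Finset.sum_nonneg fun ω _ => mul_nonneg (bernoulliWeight_nonneg p.2.1 p.2.2 ω)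
    (integral_nonneg (P.lowCount_nonneg A ω))

/-- Bids matter only through whether they reach the high price: `α` is the guaranteed mean reward of
a slot with a high bid, and `γ` what a low bid may lose from it. Costs are handled by negating the
reward. -/
theorem le_integral_sum_reward (p : unitInterval) {g : Bool → ℝ≥0 → ℝ}
    (hg : ∀ x, Measurable (g x)) (hb : ∀ x b, |g x b| ≤ 1) {α γ : ℝ}
    (hlow : ∀ b, b < P.hi → α - γ ≤ p * g true b + (1 - p) * g false b)
    (hhigh : ∀ b, P.hi ≤ b → α ≤ p * g true b + (1 - p) * g false b) :
    α * T - γ * P.expLowCount A T p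
      ≤ ∫ z, ∑ t, g (z.1 t) (bidAt A (P.inputLaw p) z.1 z.2 t) ∂(runLaw A (P.inputLaw p) T) := by
  have hw := fun ω : Fin T → Bool => bernoulliWeight_nonneg p.2.1 p.2.2 ω
  have hi : ∀ ω : Fin T → Bool, Integrable
      (fun s => bernoulliWeight p ω * (α * T - γ * P.lowCount A ω s)) A.seedLaw := fun ω =>
    ((integrable_const _).sub ((P.integrable_lowCount A ω).const_mul γ)).const_mul _
  have hL : α * T - γ * P.expLowCount A T p
      = ∫ s, ∑ ω : Fin T → Bool, bernoulliWeight p ω * (α * T - γ * P.lowCount A ω s)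
        ∂A.seedLaw := by
    rw [integral_finsetSum _ fun ω _ => hi ω]
    have : ∀ ω : Fin T → Bool,
        ∫ s, bernoulliWeight p ω * (α * T - γ * P.lowCount A ω s) ∂A.seedLaw
          = bernoulliWeight p ω * (α * T)
            - γ * (bernoulliWeight p ω * ∫ s, P.lowCount A ω s ∂A.seedLaw) := fun ω => by
      rw [integral_const_mul, integral_sub (integrable_const _)
        ((P.integrable_lowCount A ω).const_mul γ), integral_const_mul γ]
      simp
      ring
    simp only [this]
    rw [Finset.sum_sub_distrib, ← Finset.sum_mul, sum_bernoulliWeight, ← Finset.mul_sum, one_mul,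
      expLowCount]
  rw [P.integral_sum_reward A p hg hb, hL]
  refine integral_mono (integrable_finsetSum _ fun ω _ => hi ω)
    (integrable_finsetSum _ fun ω _ => Integrable.const_mul (integrable_finsetSum _ fun t _ =>
      ((integrable_of_abs_le ((hg true).comp (P.measurable_bid A ω t))
        fun s => hb _ _).const_mul _).add
      ((integrable_of_abs_le ((hg false).comp (P.measurable_bid A ω t))
        fun s => hb _ _).const_mul _)) _) fun s => ?_
  refine Finset.sum_le_sum fun ω _ => mul_le_mul_of_nonneg_left ?_ (hw ω)
  have : α * T - γ * P.lowCount A ω s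
      = ∑ t : Fin T, (α - γ * if P.bid A ω s t < P.hi then 1 else 0) := by
    rw [Finset.sum_sub_distrib, ← Finset.mul_sum, lowCount]
    simp [mul_comm]
  rw [this]
  refine Finset.sum_le_sum fun t _ => ?_
  split_ifs with h
  · simpa using hlow _ h
  · simpa using hhigh _ (not_lt.1 h)

theorem measurable_gain (x : Bool) :
    Measurable fun b => P.v * if P.threshold x ≤ b then (1 : ℝ) else 0 :=
  ((P.measurable_ite_threshold fun _ => 1).comp measurable_prodMk_left).const_mul P.v

theorem abs_gain_le (x : Bool) (b : ℝ≥0) :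
    |P.v * if P.threshold x ≤ b then (1 : ℝ) else 0| ≤ 1 := by
  obtain ⟨h0, h1⟩ := P.v_mem
  rw [abs_le]
  split_ifs <;> constructor <;> linarith

theorem measurable_payment (x : Bool) :
    Measurable fun b => if P.threshold x ≤ b then (P.threshold x : ℝ) else 0 :=
  (P.measurable_ite_threshold fun x => P.threshold x).comp measurable_prodMk_left

theorem abs_payment_le (x : Bool) (b : ℝ≥0) :
    |if P.threshold x ≤ b then (P.threshold x : ℝ) else 0| ≤ 1 := by
  have h1 : (P.threshold x : ℝ) ≤ 1 := by exact_mod_cast P.threshold_le_one x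
  have h0 : 0 ≤ (P.threshold x : ℝ) := NNReal.coe_nonneg _
  rw [abs_le]
  split_ifs <;> constructor <;> linarith

theorem threshold_true : P.threshold true = P.lo := rfl

theorem threshold_false : P.threshold false = P.hi := rfl

theorem expValue_le (p : unitInterval) (T : ℕ) :
    expValue A (P.inputLaw p) T ≤ P.v * T - P.v * (1 - p) * P.expLowCount A T p := by
  obtain ⟨h0, h1⟩ := P.v_mem
  obtain ⟨p0, p1⟩ := p.2
  have key := P.le_integral_sum_reward A (T := T) p
    (g := fun x b => -(P.v * if P.threshold x ≤ b then (1 : ℝ) else 0))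
    (α := -P.v) (γ := -(P.v * (1 - p)))
    (fun x => (P.measurable_gain x).neg) (fun x b => by rw [abs_neg]; exact P.abs_gain_le x b)
    (fun b hb => by
      have hp := mul_nonneg p0 h0
      rw [threshold_true, threshold_false, if_neg (not_le.2 hb)]
      split_ifs <;> linarith)
    (fun b hb => by
      rw [threshold_true, threshold_false, if_pos hb, if_pos (P.lo_lt_hi.le.trans hb)]
      linarith)
  simp only [Finset.sum_neg_distrib, integral_neg] at key
  have : expValue A (P.inputLaw p) T = ∫ z, ∑ t, (P.v * if P.threshold (z.1 t) ≤
      bidAt A (P.inputLaw p) z.1 z.2 t then (1 : ℝ) else 0) ∂(runLaw A (P.inputLaw p) T) := rfl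
  rw [this]
  linarith

/-- A low bid only avoids the loss `hi - v` on high thresholds. As `lo ≤ v`, bidding below `lo` as
well cannot decrease the violation further. -/
theorem le_expCCV (p : unitInterval) (T : ℕ) (hlo : (P.lo : ℝ) ≤ P.v) :
    ((p : ℝ) * P.lo + (1 - p) * P.hi - P.v) * T - (1 - p) * (P.hi - P.v) * P.expLowCount A T p
      ≤ expCCV A (P.inputLaw p) T := by
  obtain ⟨h0, h1⟩ := P.v_mem
  obtain ⟨p0, p1⟩ := p.2
  have key := P.le_integral_sum_reward A (T := T) p
    (g := fun x b => (if P.threshold x ≤ b then (P.threshold x : ℝ) else 0)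
      - P.v * if P.threshold x ≤ b then (1 : ℝ) else 0)
    (α := (p : ℝ) * P.lo + (1 - p) * P.hi - P.v) (γ := (1 - p) * (P.hi - P.v))
    (fun x => (P.measurable_payment x).sub (P.measurable_gain x)) (fun x b => by
      have h1 : (P.threshold x : ℝ) ≤ 1 := by exact_mod_cast P.threshold_le_one x
      have h0 : 0 ≤ (P.threshold x : ℝ) := NNReal.coe_nonneg _
      rw [abs_le]
      split_ifs <;> constructor <;> linarith)
    (fun b hb => by
      have hp := mul_nonneg p0 (sub_nonneg.2 hlo)
      rw [threshold_true, threshold_false, if_neg (not_le.2 hb), if_neg (not_le.2 hb)]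
      split_ifs <;> linarith)
    (fun b hb => by
      have := P.lo_lt_hi.le.trans hb
      rw [threshold_true, threshold_false, if_pos hb, if_pos hb, if_pos this, if_pos this]
      linarith)
  refine key.trans_eq (integral_congr_ae (Filter.Eventually.of_forall fun z => ?_))
  refine Finset.sum_congr rfl fun t _ => ?_
  exact congrArg (· - _) (P.payment_inputLaw p _ _).symm

/-! ### Fixed schedules -/

/-- Bid the low price in the first `m` slots and the high price afterwards. -/
def schedule (m : ℕ) : OnlineAlg where
  Seed := Unit
  seedLaw := Measure.dirac ()
  bid t _ _ _ := if t < m then P.lo else P.hi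
  measurable_bid _ := measurable_const

theorem integral_schedule (p : unitInterval) {m T : ℕ} (hm : m ≤ T) {g : Bool → ℝ≥0 → ℝ}
    (hg : ∀ x, Measurable (g x)) (hb : ∀ x b, |g x b| ≤ 1) :
    ∫ z, ∑ t, g (z.1 t) (bidAt (P.schedule m) (P.inputLaw p) z.1 z.2 t)
        ∂(runLaw (P.schedule m) (P.inputLaw p) T)
      = m * (p * g true P.lo + (1 - p) * g false P.lo)
        + (T - m) * (p * g true P.hi + (1 - p) * g false P.hi) := by
  rw [P.integral_sum_reward _ p hg hb]
  have hbid : ∀ (ω : Fin T → Bool) s t, P.bid (P.schedule m) ω s t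
      = if (t : ℕ) < m then P.lo else P.hi := fun _ _ _ => rfl
  simp only [hbid]
  rw [← Finset.sum_mul, sum_bernoulliWeight, one_mul, integral_const]
  simp only [probReal_univ, one_smul]
  rw [Fin.sum_univ_eq_sum_range (fun t => (p : ℝ) * g true (if t < m then P.lo else P.hi)
    + (1 - p) * g false (if t < m then P.lo else P.hi)) T, ← Finset.sum_range_add_sum_Ico _ hm]
  congr 1
  · rw [Finset.sum_congr rfl fun t ht => by rw [if_pos (Finset.mem_range.1 ht)]]
    simp [mul_add]
  · rw [Finset.sum_congr rfl fun t ht => by rw [if_neg (not_lt.2 (Finset.mem_Ico.1 ht).1)]]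
    simp [Nat.cast_sub hm, mul_add]

/-- The benchmark is tested on the schedule with `m` low bids; the hypothesis `h` is its ROSC. -/
theorem le_optValue (p : unitInterval) {m T : ℕ} (hm : m ≤ T)
    (h : m * ((p : ℝ) * P.lo) + (T - m) * (p * P.lo + (1 - p) * P.hi)
      ≤ m * (p * P.v) + (T - m) * P.v) :
    P.v * T - P.v * (1 - p) * m ≤ optValue (P.inputLaw p) T := by
  have hlt := not_le.2 P.lo_lt_hi
  have hle := P.lo_lt_hi.le
  have hV : expValue (P.schedule m) (P.inputLaw p) T = m * (p * P.v) + (T - m) * P.v := by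
    refine (P.integral_schedule p hm P.measurable_gain P.abs_gain_le).trans ?_
    rw [threshold_true, threshold_false, if_pos le_rfl, if_neg hlt, if_pos hle, if_pos le_rfl]
    ring
  have hP : ∫ z, pathPayment (P.schedule m) (P.inputLaw p) T z
      ∂(runLaw (P.schedule m) (P.inputLaw p) T)
      = m * ((p : ℝ) * P.lo) + (T - m) * (p * P.lo + (1 - p) * P.hi) := by
    refine Eq.trans (integral_congr_ae (Filter.Eventually.of_forall fun z =>
      Finset.sum_congr rfl fun t _ => P.payment_inputLaw p _ _)) ?_
    refine (P.integral_schedule p hm P.measurable_payment P.abs_payment_le).trans ?_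
    rw [threshold_true, threshold_false, if_pos le_rfl, if_neg hlt, if_pos hle, if_pos le_rfl]
    ring
  have hROSC : SatisfiesROSC (P.schedule m) (P.inputLaw p) T := by
    rw [SatisfiesROSC, hP]
    exact h.trans_eq hV.symm
  have := expValue_le_optValue hROSC
  rw [hV] at this
  linarith

/-! ### Change of measure for the number of low bids -/

theorem sq_expLowCount_le {T : ℕ} {p ε δ : ℝ} (h0 : 0 ≤ p - ε) (h1 : p + ε ≤ 1)
    (hε : 0 ≤ ε) (hδ : δ ≤ 1) (hp : (1 - δ) * p ^ 2 ≤ p ^ 2 - ε ^ 2)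
    (hq : (1 - δ) * (1 - p) ^ 2 ≤ (1 - p) ^ 2 - ε ^ 2) :
    (1 - δ) ^ T * P.expLowCount A T p ^ 2
      ≤ P.expLowCount A T (p + ε) * P.expLowCount A T (p - ε) :=
  sq_sum_bernoulliWeight_le h0 h1 hε hδ hp hq fun ω => integral_nonneg (P.lowCount_nonneg A ω)

theorem sq_expLowCount_half_le {T : ℕ} {ε : ℝ} (hε0 : 0 ≤ ε) (hε1 : ε ≤ 1 / 16)
    (hεT : ε ^ 2 * T ≤ 1 / 256) :
    P.expLowCount A T (1 / 2 - ε) ^ 2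
      ≤ 2 * (P.expLowCount A T (1 / 2) * P.expLowCount A T (1 / 2 - ε - ε)) := by
  have hδ : 8 * ε ^ 2 ≤ 1 := by nlinarith
  have hlo : 1 / 8 ≤ (1 / 2 - ε) ^ 2 := by nlinarith
  have hhi : 1 / 8 ≤ (1 - (1 / 2 - ε)) ^ 2 := by nlinarith
  -- Both outcome probabilities have square at least 1/8, so δ = 8ε² is admissible; Bernoulli's
  -- inequality then keeps (1 - δ)^T above 1/2.
  have h := P.sq_expLowCount_le A (T := T) (p := 1 / 2 - ε) (ε := ε) (δ := 8 * ε ^ 2)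
    (by linarith) (by linarith) hε0 hδ
    (by linarith [mul_le_mul_of_nonneg_left hlo (sq_nonneg ε)])
    (by linarith [mul_le_mul_of_nonneg_left hhi (sq_nonneg ε)])
  rw [sub_add_cancel] at h
  have hB : 1 / 2 ≤ (1 - 8 * ε ^ 2) ^ T := by
    have := one_add_mul_le_pow (a := -(8 * ε ^ 2)) (by linarith) T
    rw [← sub_eq_add_neg 1 (8 * ε ^ 2)] at this
    linarith
  have := mul_le_mul_of_nonneg_right hB (sq_nonneg (P.expLowCount A T (1 / 2 - ε)))
  linarith

end TwoPriceAuction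

/-! ### The lower bound -/

/-- The trade-off between regret `R` and violation `C`, in terms of the expected numbers `E₀`, `E₁`,
`E₂` of low bids under three equally spaced coin biases. -/
theorem add_lower_bound {v d m q R C E₀ E₁ E₂ : ℝ} (hd0 : 0 < d) (hdv : 2 * d ≤ v) (hm : 0 < m)
    (hq : 1 / 2 ≤ q) (hE₀ : 0 ≤ E₀) (hE₂ : 0 ≤ E₂) (hR₀ : v / 2 * E₀ ≤ R)
    (hC₀ : -(d / 2 * E₀) ≤ C) (hC₁ : d * (m / 8 - E₁) ≤ C) (hR₂ : v * q * (E₂ - m) ≤ R)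
    (hCS : E₁ ^ 2 ≤ 2 * (E₀ * E₂)) : d / 2048 * m ≤ R + C := by
  by_contra! hcon
  have hdE : d * E₀ ≤ R := by
    have := mul_le_mul_of_nonneg_right hdv hE₀
    linarith
  -- `C` may be negative, since low bids bank a surplus, but `hC₀` and `hdE` limit this to half of
  -- the regret.
  have hRC : R / 2 ≤ R + C := by linarith
  have hE₀' : E₀ ≤ m / 1024 := by
    refine le_of_mul_le_mul_left ?_ hd0
    linarith
  have hE₁' : m / 16 ≤ E₁ := by
    refine le_of_mul_le_mul_left ?_ hd0
    have : 0 ≤ d * E₀ := mul_nonneg hd0.le hE₀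
    have : 0 ≤ d * m := by positivity
    linarith
  have hE₂' : E₂ ≤ m + m / 1024 := by
    by_contra! h2
    have hdq : d ≤ v * q := by nlinarith
    have := mul_le_mul_of_nonneg_right hdq (show 0 ≤ E₂ - m by linarith)
    have : d * (m / 1024) < d * (E₂ - m) := mul_lt_mul_of_pos_left (by linarith) hd0
    linarith
  have h1 := mul_le_mul hE₀' hE₂' hE₂ (by positivity)
  have h2 : (m / 16 : ℝ) ^ 2 ≤ E₁ ^ 2 := pow_le_pow_left₀ (by positivity) hE₁' 2
  have : 0 < m ^ 2 := by positivity
  -- The contradiction: m²/256 ≤ E₁² ≤ 2 · (m/1024) · (m + m/1024), which is about m²/512.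
  linarith

theorem threshold_lower_bound {v d : ℝ} (hd0 : 0 < d) (hdv : 2 * d ≤ v) (hdv' : v + 2 * d ≤ 1)
    {T : ℕ} (hT : 1 ≤ T) (A : OnlineAlg) :
    d / 4096 * √T ≤ regret (thresholdLaws v) A T + worstCCV (thresholdLaws v) A T := by
  let P : TwoPriceAuction :=
    { v := v
      lo := ⟨v - d, by linarith⟩
      hi := ⟨v + d, by linarith⟩
      v_mem := ⟨by linarith, by linarith⟩
      lo_pos := NNReal.coe_pos.1 (show 0 < v - d by linarith)
      lo_lt_hi := NNReal.coe_lt_coe.1 (show v - d < v + d by linarith)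
      hi_le_one := NNReal.coe_le_coe.1 (show v + d ≤ 1 by linarith) }
  have hPv : P.v = v := rfl
  have hPlo : (P.lo : ℝ) = v - d := rfl
  have hPhi : (P.hi : ℝ) = v + d := rfl
  have hTpos : (0 : ℝ) < T := by exact_mod_cast hT
  set m := Nat.sqrt T with hm
  have hm1 : 1 ≤ m := Nat.sqrt_pos.2 hT
  have hmT : m ≤ T := Nat.sqrt_le_self T
  have hm2 : (m : ℝ) ^ 2 ≤ T := by exact_mod_cast Nat.sqrt_le' T
  have hm1' : (1 : ℝ) ≤ m := by exact_mod_cast hm1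
  have hmT' : (m : ℝ) ≤ T := by exact_mod_cast hmT
  have hsqrt : √(T : ℝ) ≤ 2 * m := by
    have : (T : ℝ) ≤ (m + 1) ^ 2 := by exact_mod_cast (Nat.lt_succ_sqrt' T).le
    calc √(T : ℝ) ≤ m + 1 := Real.sqrt_le_iff.2 ⟨by positivity, this⟩
      _ ≤ 2 * m := by linarith
  -- Large enough for an overspend 2dεT = dm/8 of order √T, small enough that ε²T ≤ 1/256 keeps the
  -- laws comparable.
  set ε : ℝ := m / (16 * T) with hε
  have hε0 : 0 ≤ ε := by positivity
  have hεT : ε * T = m / 16 := by rw [hε]; field_simp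
  have hε1 : ε ≤ 1 / 16 := by
    rw [hε, div_le_iff₀ (by positivity)]; linarith
  have hεsq : ε ^ 2 * T ≤ 1 / 256 := by
    have : ε ^ 2 * T = m ^ 2 / (256 * T) := by rw [hε]; field_simp; norm_num
    rw [this, div_le_iff₀ (by positivity)]; linarith
  let p₀ : unitInterval := ⟨1 / 2, by norm_num, by norm_num⟩
  let p₁ : unitInterval := ⟨1 / 2 - ε, by linarith, by linarith⟩
  let p₂ : unitInterval := ⟨1 / 2 - ε - ε, by linarith, by linarith⟩
  have hp₀ : (p₀ : ℝ) = 1 / 2 := rfl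
  have hp₁ : (p₁ : ℝ) = 1 / 2 - ε := rfl
  have hp₂ : (p₂ : ℝ) = 1 / 2 - ε - ε := rfl
  set R := regret (thresholdLaws v) A T
  set C := worstCCV (thresholdLaws v) A T
  have hE₀ := P.expLowCount_nonneg A (T := T) p₀
  have hE₁ := P.expLowCount_nonneg A (T := T) p₁
  have hE₂ := P.expLowCount_nonneg A (T := T) p₂
  have hR₀ : v / 2 * P.expLowCount A T p₀ ≤ R := by
    -- With the fair coin the mean price is exactly `v`, so no low bids are needed.
    have h := P.le_optValue p₀ (m := 0) (Nat.zero_le T) (by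
      rw [hp₀, hPlo, hPhi, hPv]; push_cast; linarith)
    have h' := P.expValue_le A p₀ T
    have h'' := le_regret (P.inputLaw_mem p₀) A T
    rw [hPv] at h h' h''
    rw [hp₀] at h h'
    push_cast at h
    linarith
  have hC₀ : -(d / 2 * P.expLowCount A T p₀) ≤ C := by
    have h := P.le_expCCV A p₀ T (by rw [hPlo, hPv]; linarith)
    have h' := le_worstCCV (P.inputLaw_mem p₀) A T
    rw [hPv] at h h'
    rw [hPlo, hPhi, hp₀] at h
    linarith
  have hC₁ : d * (m / 8 - P.expLowCount A T p₁) ≤ C := by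
    have h := P.le_expCCV A p₁ T (by rw [hPlo, hPv]; linarith)
    have h' := le_worstCCV (P.inputLaw_mem p₁) A T
    rw [hPv] at h h'
    rw [hPlo, hPhi] at h
    have e1 : ((p₁ : ℝ) * (v - d) + (1 - p₁) * (v + d) - v) * T = d * (m / 8) := by
      rw [hp₁]; linear_combination 2 * d * hεT
    have e2 : (1 - (p₁ : ℝ)) * (v + d - v) ≤ d := by rw [hp₁]; nlinarith
    have e3 := mul_le_mul_of_nonneg_right e2 hE₁
    linarith
  have hR₂ : v * (1 - p₂) * (P.expLowCount A T p₂ - m) ≤ R := by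
    -- Always bidding high overspends by 4dεT = dm/4, while `m` low bids save dm(1/2 + 2ε), which is
    -- more.
    have h := P.le_optValue p₂ hmT (by
      rw [hPlo, hPhi, hPv]
      have : (m : ℝ) * (p₂ * (v - d)) + (T - m) * (p₂ * (v - d) + (1 - p₂) * (v + d))
          - (m * (p₂ * v) + (T - m) * v) = -(d * m * (1 / 4 + 2 * ε)) := by
        rw [hp₂]; linear_combination 4 * d * hεT
      have : 0 ≤ d * m * (1 / 4 + 2 * ε) := by positivity
      linarith)
    have h' := P.expValue_le A p₂ T
    have h'' := le_regret (P.inputLaw_mem p₂) A T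
    rw [hPv] at h h' h''
    linarith
  have hCS : P.expLowCount A T p₁ ^ 2 ≤ 2 * (P.expLowCount A T p₀ * P.expLowCount A T p₂) := by
    exact P.sq_expLowCount_half_le A hε0 hε1 hεsq
  have hq : 1 / 2 ≤ 1 - (p₂ : ℝ) := by rw [hp₂]; linarith
  have := mul_le_mul_of_nonneg_left hsqrt (show 0 ≤ d / 4096 by positivity)
  linarith [add_lower_bound hd0 hdv (by linarith) hq hE₀ hE₂ hR₀ hC₀ hC₁ hR₂ hCS]

/-! ### From threshold inputs to all repeated auctions -/

theorem thresholdLaws_subset (v : ℝ) : thresholdLaws v ⊆ repeatedLaws v := fun _ h => h.1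

theorem regret_mono {𝒟 𝒟' : Set InputLaw} (h : 𝒟 ⊆ 𝒟') (hne : 𝒟.Nonempty) (A : OnlineAlg)
    (T : ℕ) : regret 𝒟 A T ≤ regret 𝒟' A T := by
  obtain ⟨D, hD⟩ := hne
  refine csSup_le ⟨_, D, hD, rfl⟩ ?_
  rintro r ⟨D, hD, rfl⟩
  exact le_regret (h hD) A T

theorem worstCCV_mono {𝒟 𝒟' : Set InputLaw} (h : 𝒟 ⊆ 𝒟') (hne : 𝒟.Nonempty) (A : OnlineAlg)
    (T : ℕ) : worstCCV 𝒟 A T ≤ worstCCV 𝒟' A T := by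
  obtain ⟨D, hD⟩ := hne
  refine csSup_le ⟨_, D, hD, rfl⟩ ?_
  rintro r ⟨D, hD, rfl⟩
  exact le_worstCCV (h hD) A T

theorem thresholdLaws_nonempty {v : ℝ} (hv0 : 0 ≤ v) (hv1 : v ≤ 1) : (thresholdLaws v).Nonempty :=
  let P : TwoPriceAuction :=
    { v := v, lo := 1 / 2, hi := 1, v_mem := ⟨hv0, hv1⟩, lo_pos := by positivity
      lo_lt_hi := NNReal.half_lt_self one_ne_zero, hi_le_one := le_rfl }
  ⟨P.inputLaw 0, P.inputLaw_mem 0⟩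

end AutoBid

end

theorem mainTheorem2 (v : ℝ) (hv0 : 0 < v) (hv1 : v < 1) :
    ∃ c : ℝ, 0 < c ∧ ∀ T : ℕ, 1 ≤ T → ∀ A : AutoBid.OnlineAlg,
      c * Real.sqrt T ≤ AutoBid.regret (AutoBid.repeatedLaws v) A T
          + AutoBid.worstCCV (AutoBid.repeatedLaws v) A T ∧
      c * Real.sqrt T ≤ AutoBid.regret (AutoBid.thresholdLaws v) A T
          + AutoBid.worstCCV (AutoBid.thresholdLaws v) A T := by
  have hd : 0 < min v (1 - v) / 2 := half_pos (lt_min hv0 (by linarith))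
  -- Here d = min(v, 1 - v)/2 keeps both prices in (0, 1]; 4096 is 2048 from `add_lower_bound` times
  -- 2 from √T ≤ 2m.
  refine ⟨min v (1 - v) / 2 / 4096, by positivity, fun T hT A => ?_⟩
  have key := AutoBid.threshold_lower_bound (v := v) hd (by linarith [min_le_left v (1 - v)])
    (by linarith [min_le_right v (1 - v)]) hT A
  have hsub := AutoBid.thresholdLaws_subset v
  have hne := AutoBid.thresholdLaws_nonempty hv0.le hv1.le
  exact ⟨key.trans (add_le_add (AutoBid.regret_mono hsub hne A T)
    (AutoBid.worstCCV_mono hsub hne A T)), key⟩
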